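/- Let $(\mathcal V,\otimes,I,\tau)$ be a braided monoidal category which has all equalisers and all coequalisers, and let $\mathcal A=(A,m,e)$ be an algebra (monoid object) in $\mathcal V$. Associativity and unit isomorphisms of $\mathcal V$ are suppressed in the notation. Conventions. Let $\mathcal A^\tau=(A,\,m\cdot\tau_{A,A},\,e)$ be the opposite algebra, write $m^\tau=m\cdot\tau_{A,A}$, and let $\mathcal A^e=\mathcal A\otimes\mathcal A^\tau$ be the braided tensor product, i.e. the object $A\otimes A$ with multiplication $(m\otimes m^\tau)\cdot(A\otimes\tau_{A,A}\otimes A)$ and unit $e\otimes e$. Then $A$ is a left $\mathcal A^e$-module with action $m\cdot(A\otimes m^\tau):A\otimes A\otimes A\to A$. * $\mathcal A$ is *left Azumaya* if the functor $\overline K_l:\mathcal V\to{}_{\mathcal A^e}\mathcal V$, $X\mapsto \big(A\otimes X,\ (m\cdot(A\otimes m^\tau))\otimes X\big)$, is an equivalence of categories. * $\mathcal A$ is *separable* if there is $\xi:A\to A\otimes A$ with $m\cdot\xi=1_A$ and $(A\otimes m)\cdot(\xi\otimes A)=\xi\cdot m=(m\otimes A)\cdot(A\otimes\xi)$. * A *left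 dual* of an object $V$ consists of an object $V^*$ with morphisms $\mathrm{db}:I\to V\otimes V^*$ and $\mathrm{ev}:V^*\otimes V\to I$ such that $(V\otimes\mathrm{ev})\cdot(\mathrm{db}\otimes V)=1_V$ and $(\mathrm{ev}\otimes V^*)\cdot(V^*\otimes\mathrm{db})=1_{V^*}$. It defines an algebra $\mathcal S_{V,V^*}=(V\otimes V^*,\ V\otimes\mathrm{ev}\otimes V^*,\ \mathrm{db})$. * $V$ is a *progenerator* if it has a left dual for which $\mathrm{ev}$ is a split epimorphism. * For an algebra $\mathcal B=(B,m_B,e_B)$, a left $\mathcal B$-module $(V,\rho)$ is *Galois* if $V$ has a left dual $(V^*,\mathrm{db},\mathrm{ev})$ for which $(\rho\otimes V^*)\cdot(B\otimes\mathrm{db}):B\to V\otimes V^*$ is an isomorphism of algebras $\mathcal B\to\mathcal S_{V,V^*}$. (A left dual is unique up to unique compatible isomorphism, so these notions do not depend on its choice.) Theorem. The following are equivalent: (a) $\mathcal A$ is separable and left Azumaya; (b) $A$ is a progenerator and, for a left dual $(A^*,\mathrm{db},\mathrm{ev})$ of $A$, the composite $$\overline\chi_0:\ A\otimes A\xrightarrow{A\otimes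 A\otimes\mathrm{db}}A\otimes A\otimes A\otimes A^*\xrightarrow{A\otimes\tau_{A,A}\otimes A^*}A\otimes A\otimes A\otimes A^*\xrightarrow{m\otimes A\otimes A^*}A\otimes A\otimes A^*\xrightarrow{m\otimes A^*}A\otimes A^*$$ is an isomorphism of algebras $\mathcal A^e\to\mathcal S_{A,A^*}$; (c) $e:I\to A$ is a split monomorphism and the left $\mathcal A^e$-module $\big(A,\ m\cdot(A\otimes m^\tau)\big)$ is Galois. -/

import Mathlib

open CategoryTheory MonoidalCategory Limits

universe v u

namespace BraidedAzumaya

section Monoidal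

variable {V : Type u} [Category.{v} V] [MonoidalCategory V]

theorem dual_one_mul (X D : V) [ExactPairing X D] :
    η_ X D ▷ (X ⊗ D) ≫ (α_ X D (X ⊗ D)).hom ≫ X ◁ (α_ D X D).inv ≫ X ◁ (ε_ X D ▷ D) ≫
      X ◁ (λ_ D).hom = (λ_ (X ⊗ D)).hom := by
  calc _ = 𝟙 _ ⊗≫ (η_ X D ▷ X ⊗≫ X ◁ ε_ X D) ▷ D ⊗≫ 𝟙 _ := by monoidal
    _ = _ := by rw [ExactPairing.evaluation_coevaluation'']; monoidal

theorem dual_mul_one (X D : V) [ExactPairing X D] :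
    (X ⊗ D) ◁ η_ X D ≫ (α_ X D (X ⊗ D)).hom ≫ X ◁ (α_ D X D).inv ≫ X ◁ (ε_ X D ▷ D) ≫
      X ◁ (λ_ D).hom = (ρ_ (X ⊗ D)).hom := by
  calc _ = 𝟙 _ ⊗≫ X ◁ (D ◁ η_ X D ⊗≫ ε_ X D ▷ D) ⊗≫ 𝟙 _ := by monoidal
    _ = _ := by rw [ExactPairing.coevaluation_evaluation'']; monoidal

theorem dual_mul_assoc (X D : V) (e : D ⊗ X ⟶ 𝟙_ V) :
    ((α_ X D (X ⊗ D)).hom ≫ X ◁ (α_ D X D).inv ≫ X ◁ (e ▷ D) ≫ X ◁ (λ_ D).hom) ▷ (X ⊗ D) ≫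
      ((α_ X D (X ⊗ D)).hom ≫ X ◁ (α_ D X D).inv ≫ X ◁ (e ▷ D) ≫ X ◁ (λ_ D).hom) =
    (α_ (X ⊗ D) (X ⊗ D) (X ⊗ D)).hom ≫
      (X ⊗ D) ◁ ((α_ X D (X ⊗ D)).hom ≫ X ◁ (α_ D X D).inv ≫ X ◁ (e ▷ D) ≫ X ◁ (λ_ D).hom) ≫
      ((α_ X D (X ⊗ D)).hom ≫ X ◁ (α_ D X D).inv ≫ X ◁ (e ▷ D) ≫ X ◁ (λ_ D).hom) := by
  calc _ = 𝟙 _ ⊗≫ X ◁ (e ▷ (D ⊗ X) ≫ (𝟙_ V) ◁ e) ▷ D ⊗≫ 𝟙 _ := by monoidal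
    _ = _ := by rw [← whisker_exchange]; monoidal

/-- A morphism `f : A ⟶ B` of `V` between the carriers of two algebras is an isomorphism of
algebras if it underlies an isomorphism in the category of algebras (monoid objects) of `V`. -/
def IsAlgebraIso {A B : Mon V} (f : A.X ⟶ B.X) : Prop :=
  ∃ e : A ≅ B, e.hom.hom = f

/-- A separable algebra: the multiplication `A ⊗ A ⟶ A` has a section which is a morphism
of `(A, A)`-bimodules. -/
def IsSeparableAlgebra (A : Mon V) : Prop :=
  ∃ ξ : A.X ⟶ A.X ⊗ A.X,
    ξ ≫ MonObj.mul = 𝟙 A.X ∧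
    ξ ▷ A.X ≫ (α_ A.X A.X A.X).hom ≫ A.X ◁ MonObj.mul = MonObj.mul ≫ ξ ∧
    A.X ◁ ξ ≫ (α_ A.X A.X A.X).inv ≫ MonObj.mul ▷ A.X = MonObj.mul ≫ ξ

/-- The algebra `X ⊗ D`, with multiplication `X ⊗ ev ⊗ D` and unit `db`, of an object `X` with
a dual `(D, db : 𝟙 ⟶ X ⊗ D, ev : D ⊗ X ⟶ 𝟙)`. In Mathlib such a dual is an `ExactPairing X D`,
`db` is written `η_ X D` and `ev` is written `ε_ X D`. -/
def dualAlgebra (X D : V) [ExactPairing X D] : Mon V where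
  X := X ⊗ D
  mon :=
    { one := η_ X D
      mul := (α_ X D (X ⊗ D)).hom ≫ X ◁ (α_ D X D).inv ≫ X ◁ (ε_ X D ▷ D) ≫ X ◁ (λ_ D).hom
      one_mul := dual_one_mul X D
      mul_one := dual_mul_one X D
      mul_assoc := dual_mul_assoc X D (ε_ X D) }

/-- A progenerator: an object `X` with a dual `(D, db : 𝟙 ⟶ X ⊗ D, ev : D ⊗ X ⟶ 𝟙)` for which
`ev` is a split epimorphism. -/
def IsProgenerator (X : V) : Prop :=
  ∃ (D : V) (_ : ExactPairing X D), IsSplitEpi (ε_ X D)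

/-- The action `A ⊗ M ⟶ M` of a left module. -/
def action (A : Mon V) (M : Mod V A.X) : A.X ⊗ M.X ⟶ M.X :=
  ModObj.smul (M := A.X) (X := M.X)

/-- The composite `A ⟶ A ⊗ M ⊗ D ⟶ M ⊗ D` of `A ⊗ db` and `action ⊗ D`. -/
def galoisMap (A : Mon V) (M : Mod V A.X) (D : V) [ExactPairing M.X D] :
    A.X ⟶ M.X ⊗ D :=
  (ρ_ A.X).inv ≫ A.X ◁ η_ M.X D ≫ (α_ A.X M.X D).inv ≫ action A M ▷ D

/-- A left `A`-module `M` is Galois if it has a dual `D` for which the canonical morphism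
`A ⟶ M ⊗ D` is an isomorphism of algebras. -/
def IsGaloisModule (A : Mon V) (M : Mod V A.X) : Prop :=
  ∃ (D : V) (_ : ExactPairing M.X D),
    IsAlgebraIso (A := A) (B := dualAlgebra M.X D) (galoisMap A M D)

theorem tensor_one_smul (A : Mon V) (M : Mod V A.X) (X : V) :
    (MonObj.one : 𝟙_ V ⟶ A.X) ▷ (M.X ⊗ X) ≫ (α_ A.X M.X X).inv ≫ action A M ▷ X =
      (λ_ (M.X ⊗ X)).hom := by
  rw [associator_inv_naturality_left_assoc, ← comp_whiskerRight, action,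
    ModObj.one_smul_self]
  monoidal

theorem tensor_mul_smul (A : Mon V) (M : Mod V A.X) (X : V) :
    (MonObj.mul : A.X ⊗ A.X ⟶ A.X) ▷ (M.X ⊗ X) ≫ (α_ A.X M.X X).inv ≫ action A M ▷ X =
    (α_ A.X A.X (M.X ⊗ X)).hom ≫ A.X ◁ ((α_ A.X M.X X).inv ≫ action A M ▷ X) ≫
      (α_ A.X M.X X).inv ≫ action A M ▷ X := by
  rw [associator_inv_naturality_left_assoc, ← comp_whiskerRight, action,
    ModObj.mul_smul_self]
  monoidal

/-- For a left `A`-module `M` and an object `X`, the left `A`-module `M ⊗ X`. -/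
def tensorModule (A : Mon V) (M : Mod V A.X) (X : V) : Mod V A.X where
  X := M.X ⊗ X
  mod :=
    { smul := (α_ A.X M.X X).inv ≫ action A M ▷ X
      one_smul := tensor_one_smul A M X
      mul_smul := tensor_mul_smul A M X }

theorem tensor_smul_hom (A : Mon V) (M : Mod V A.X) {X Y : V} (f : X ⟶ Y) :
    ((α_ A.X M.X X).inv ≫ action A M ▷ X) ≫ M.X ◁ f =
      A.X ◁ M.X ◁ f ≫ (α_ A.X M.X Y).inv ≫ action A M ▷ Y := by
  rw [associator_inv_naturality_right_assoc, Category.assoc, ← whisker_exchange]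

/-- The functor `X ↦ M ⊗ X` from `V` to left `A`-modules. -/
def tensorModuleFunctor (A : Mon V) (M : Mod V A.X) : V ⥤ Mod V A.X where
  obj X := tensorModule A M X
  map {X Y} f :=
    Mod.Hom.mk' (M := tensorModule A M X) (N := tensorModule A M Y) (M.X ◁ f)
      (tensor_smul_hom A M f)
  map_id X := Mod.hom_ext _ _ (MonoidalCategory.whiskerLeft_id M.X X)
  map_comp f g := Mod.hom_ext _ _ (MonoidalCategory.whiskerLeft_comp M.X f g)

end Monoidal

section Braided

open scoped MonObj

variable {V : Type u} [Category.{v} V] [MonoidalCategory V] [BraidedCategory V]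

theorem opposite_one_mul (A : V) [MonObj A] :
    η[A] ▷ A ≫ (β_ A A).hom ≫ μ[A] = (λ_ A).hom := by
  simp

theorem opposite_mul_one (A : V) [MonObj A] :
    A ◁ η[A] ≫ (β_ A A).hom ≫ μ[A] = (ρ_ A).hom := by
  simp

theorem opposite_mul_assoc (A : V) [MonObj A] :
    ((β_ A A).hom ≫ μ[A]) ▷ A ≫ (β_ A A).hom ≫ μ[A] =
      (α_ A A A).hom ≫ A ◁ ((β_ A A).hom ≫ μ[A]) ≫ (β_ A A).hom ≫ μ[A] := by
  have h := BraidedCategory.yang_baxter A A A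
  simp only [comp_whiskerRight, Category.assoc, MonoidalCategory.whiskerLeft_comp,
    BraidedCategory.braiding_naturality_left_assoc,
    BraidedCategory.braiding_naturality_right_assoc,
    BraidedCategory.braiding_tensor_left_hom, BraidedCategory.braiding_tensor_right_hom,
    MonObj.mul_assoc]
  simp only [← Category.assoc]
  congr 2
  rw [← cancel_epi (α_ A A A).inv]
  simp only [Category.assoc, Iso.inv_hom_id_assoc, Iso.inv_hom_id, Category.comp_id] at h ⊢
  exact h

/-- The opposite algebra: the same object and unit, with multiplication the braiding of `A`
with itself followed by the multiplication of `A`. -/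
def oppositeAlgebra (A : Mon V) : Mon V where
  X := A.X
  mon :=
    { one := η[A.X]
      mul := (β_ A.X A.X).hom ≫ μ[A.X]
      one_mul := opposite_one_mul A.X
      mul_one := opposite_mul_one A.X
      mul_assoc := opposite_mul_assoc A.X }

/-- The enveloping algebra: the braided tensor product of `A` and its opposite algebra. -/
def envelopingAlgebra (A : Mon V) : Mon V :=
  A ⊗ oppositeAlgebra A

/-- The action `(A ⊗ A) ⊗ A ⟶ A` of the enveloping algebra on `A`, the composite
`A ⊗ A ⊗ A ⟶ A ⊗ A ⊗ A ⟶ A ⊗ A ⟶ A` of `A ⊗ β`, `A ⊗ mul` and `mul`. -/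
def envelopingAction (A : V) [MonObj A] : (A ⊗ A) ⊗ A ⟶ A :=
  (α_ A A A).hom ≫ A ◁ ((β_ A A).hom ≫ μ[A]) ≫ μ[A]

theorem enveloping_one_smul (A : V) [MonObj A] :
    ((λ_ (𝟙_ V)).inv ≫ (η[A] ⊗ₘ η[A])) ▷ A ≫ envelopingAction A = (λ_ A).hom := by
  calc _ = 𝟙 _ ⊗≫ η[A] ▷ (𝟙_ V ⊗ A) ≫ A ◁ (η[A] ▷ A ≫ (β_ A A).hom ≫ μ[A]) ≫ μ[A] := by
        rw [MonoidalCategory.tensorHom_def, envelopingAction]; monoidal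
    _ = 𝟙 _ ⊗≫ 𝟙_ V ◁ (λ_ A).hom ≫ η[A] ▷ A ≫ μ[A] := by
        rw [opposite_one_mul, whisker_exchange_assoc]
    _ = _ := by rw [MonObj.one_mul]; monoidal

theorem enveloping_mul_smul (A : V) [MonObj A] :
    (tensorμ A A A A ≫ (μ[A] ⊗ₘ ((β_ A A).hom ≫ μ[A]))) ▷ A ≫ envelopingAction A =
      (α_ (A ⊗ A) (A ⊗ A) A).hom ≫ (A ⊗ A) ◁ envelopingAction A ≫ envelopingAction A := by
  have h := opposite_mul_assoc A
  have h2 : A ◁ μ[A] ≫ ((β_ A A).hom ≫ μ[A]) = (α_ A A A).inv ≫ (β_ A A).hom ▷ A ≫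
      (α_ A A A).hom ≫ A ◁ ((β_ A A).hom ≫ μ[A]) ≫ μ[A] := by
    simp
  unfold envelopingAction
  generalize (β_ A A).hom ≫ μ[A] = p at h h2 ⊢
  calc _ = 𝟙 _ ⊗≫ A ◁ (β_ A A).hom ▷ A ▷ A ⊗≫ μ[A] ▷ (A ⊗ A) ▷ A ⊗≫
            A ◁ (p ▷ A ≫ p) ≫ μ[A] := by
        simp only [tensorμ, MonoidalCategory.tensorHom_def]; monoidal
    _ = 𝟙 _ ⊗≫ A ◁ (β_ A A).hom ▷ A ▷ A ⊗≫ (μ[A] ▷ (A ⊗ A ⊗ A) ≫ A ◁ A ◁ p) ≫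
            A ◁ p ≫ μ[A] := by
        rw [h]; monoidal
    _ = 𝟙 _ ⊗≫ A ◁ (β_ A A).hom ▷ A ▷ A ⊗≫ (A ⊗ A) ◁ A ◁ p ≫
            (μ[A] ▷ (A ⊗ A) ≫ A ◁ p) ≫ μ[A] := by
        rw [← whisker_exchange]; monoidal
    _ = 𝟙 _ ⊗≫ A ◁ ((β_ A A).hom ▷ (A ⊗ A) ≫ (A ⊗ A) ◁ p) ⊗≫ (A ⊗ A) ◁ p ≫
            (μ[A] ▷ A ≫ μ[A]) := by
        rw [← whisker_exchange]; monoidal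
    _ = 𝟙 _ ⊗≫ A ◁ ((A ⊗ A) ◁ p ≫ (β_ A A).hom ▷ A) ⊗≫ (A ⊗ A) ◁ p ⊗≫
            A ◁ μ[A] ≫ μ[A] := by
        rw [← whisker_exchange, MonObj.mul_assoc]; monoidal
    _ = 𝟙 _ ⊗≫ A ◁ A ◁ A ◁ p ⊗≫ A ◁ ((α_ A A A).inv ≫ (β_ A A).hom ▷ A ≫
            (α_ A A A).hom ≫ A ◁ p ≫ μ[A]) ≫ μ[A] := by
        monoidal
    _ = _ := by
        rw [← h2]; monoidal

/-- `A` as a left module over its enveloping algebra. -/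
def selfModule (A : Mon V) : Mod V (envelopingAlgebra A).X where
  X := A.X
  mod :=
    { smul := envelopingAction A.X
      one_smul := enveloping_one_smul A.X
      mul_smul := enveloping_mul_smul A.X }

/-- The comparison functor `X ↦ A ⊗ X` from `V` to left modules over the enveloping algebra of
`A`, which acts on the factor `A`. -/
def comparisonFunctor (A : Mon V) : V ⥤ Mod V (envelopingAlgebra A).X :=
  tensorModuleFunctor (envelopingAlgebra A) (selfModule A)

/-- `A` is left Azumaya if the comparison functor is an equivalence of categories. -/
def IsLeftAzumaya (A : Mon V) : Prop :=
  (comparisonFunctor A).IsEquivalence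

/-- The morphism `A ⊗ A ⟶ A ⊗ D`, where `D` is a dual of `A`: the composite
`A ⊗ A ⟶ A ⊗ A ⊗ A ⊗ D ⟶ A ⊗ A ⊗ A ⊗ D ⟶ A ⊗ A ⊗ D ⟶ A ⊗ D` of
`A ⊗ A ⊗ db`, `A ⊗ β ⊗ D`, `mul ⊗ A ⊗ D` and `mul ⊗ D`. -/
def chiZero (A : Mon V) (D : V) [ExactPairing A.X D] : A.X ⊗ A.X ⟶ A.X ⊗ D :=
  (ρ_ (A.X ⊗ A.X)).inv ≫ (A.X ⊗ A.X) ◁ η_ A.X D ≫ (α_ (A.X ⊗ A.X) A.X D).inv ≫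
    ((α_ A.X A.X A.X).hom ≫ A.X ◁ (β_ A.X A.X).hom ≫ (α_ A.X A.X A.X).inv) ▷ D ≫
    (μ[A.X] ▷ A.X) ▷ D ≫ μ[A.X] ▷ D

end Braided

end BraidedAzumaya

/-! Write B for the enveloping algebra and M for `A` as a B-module. A dual D of M makes D ⊗ - left
adjoint to M ⊗ -, with monad M ⊗ D ⊗ -. If the canonical map B → M ⊗ D (`galoisMap`, equal to
`chiZero` here) is invertible, B-modules are the algebras of this monad and X ↦ M ⊗ X is its
comparison functor. A section of ev splits the counit naturally, which makes that functor an
equivalence as soon as idempotents split (`tensorModuleFunctor_isEquivalence`). Conversely, an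
equivalence creates the dual: D corresponds to the regular module and ev comes from fullness
(`isGaloisModule_of_isEquivalence`).

The multiplication B → M is the orbit map of the unit e, and separability says that it has a
B-linear section (`isSeparableAlgebra_iff`). For Azumaya algebras such a section yields a functional
I → D with value 1 on e, so e splits. A retraction of e yields a section of ev, and a section of ev
turns any section of the orbit map into a B-linear one. This closes the cycle of implications. -/

namespace BraidedAzumaya

/-! ### Monadicity of a right adjoint whose counit has a natural section -/

section SplitCounit

variable {C : Type*} {E : Type*} [Category* C] [Category* E] {F : E ⥤ C} {G : C ⥤ E}
  (adj : F ⊣ G) (t : 𝟭 C ⟶ G ⋙ F) (ht : t ≫ adj.counit = 𝟙 _)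

include ht in
theorem faithful_of_section_counit : G.Faithful where
  map_injective {X Y} f g hfg := by
    have key (k : X ⟶ Y) : k = t.app X ≫ F.map (G.map k) ≫ adj.counit.app Y := by
      have := congr_app ht X
      simp only [NatTrans.comp_app, NatTrans.id_app] at this
      simp [reassoc_of% this]
    rw [key f, key g, hfg]

-- Fullness of the comparison functor: `hu` says that `u` is a map of algebras for the monad on `E`.
include ht in
theorem exists_map_eq_of_section_counit {X Y : C} (u : G.obj X ⟶ G.obj Y)
    (hu : G.map (F.map u) ≫ G.map (adj.counit.app Y) = G.map (adj.counit.app X) ≫ u) :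
    ∃ f : X ⟶ Y, G.map f = u := by
  refine ⟨t.app X ≫ F.map u ≫ adj.counit.app Y, ?_⟩
  have := congr_app ht X
  simp only [NatTrans.comp_app, NatTrans.id_app] at this
  rw [G.map_comp, G.map_comp, hu, ← G.map_comp_assoc, this]
  simp

-- Essential surjectivity of the comparison functor: (`N`, `h`) is an algebra for the monad, and `X`
-- is a retract of `F.obj N` cut out by an idempotent.
include ht in
theorem exists_iso_of_section_counit [IsIdempotentComplete C] {N : E} (h : G.obj (F.obj N) ⟶ N)
    (hone : adj.unit.app N ≫ h = 𝟙 N)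
    (hmul : G.map (F.map h) ≫ h = G.map (adj.counit.app (F.obj N)) ≫ h) :
    ∃ (X : C) (a : G.obj X ≅ N), G.map (F.map a.hom) ≫ h = G.map (adj.counit.app X) ≫ a.hom := by
  have htc (X : C) : t.app X ≫ adj.counit.app X = 𝟙 X := congr_app ht X
  have hp : F.map h ≫ t.app (F.obj N) ≫ F.map h =
      adj.counit.app (F.obj N) ≫ t.app (F.obj N) ≫ F.map h := by
    have h1 := t.naturality (F.map h)
    have h2 := t.naturality (adj.counit.app (F.obj N))
    simp only [Functor.id_obj, Functor.id_map, Functor.comp_obj, Functor.comp_map] at h1 h2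
    rw [reassoc_of% h1, reassoc_of% h2, ← F.map_comp, hmul, F.map_comp]
  obtain ⟨X, i, q, hiq, hqi⟩ := IsIdempotentComplete.idempotents_split (F.obj N)
    (t.app (F.obj N) ≫ F.map h) (by
      rw [Category.assoc, hp, reassoc_of% htc])
  -- `q` coequalises the pair presenting the algebra, so `X` plays the role of the coequaliser in
  -- Beck's theorem.
  have hq : F.map h ≫ q = adj.counit.app (F.obj N) ≫ q := by
    have : q = (t.app (F.obj N) ≫ F.map h) ≫ q := by rw [← hqi, Category.assoc, hiq]; simp
    rw [this, Category.assoc, reassoc_of% hp]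
  have hGh : G.map (t.app (F.obj N) ≫ F.map h) ≫ h = h := by
    rw [G.map_comp, Category.assoc, hmul, ← G.map_comp_assoc, htc]
    simp
  have hunit : h ≫ adj.unit.app N ≫ G.map q = G.map q := by
    have := adj.unit.naturality h
    simp only [Functor.id_obj, Functor.id_map, Functor.comp_obj, Functor.comp_map] at this
    rw [reassoc_of% this, ← G.map_comp, hq, G.map_comp]
    simp
  refine ⟨X, ⟨G.map i ≫ h, adj.unit.app N ≫ G.map q, ?_, ?_⟩, ?_⟩
  · rw [Category.assoc, hunit, ← G.map_comp, hiq, G.map_id]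
  · rw [Category.assoc, ← G.map_comp_assoc, hqi, hGh, hone]
  · have := adj.counit.naturality i
    simp only [Functor.id_obj, Functor.id_map, Functor.comp_obj, Functor.comp_map] at this
    simp only [Functor.map_comp, Category.assoc]
    rw [hmul, ← G.map_comp_assoc, this, G.map_comp_assoc]

end SplitCounit

/-! ### The adjunction given by a dual, and the canonical map of a module -/

section Monoidal

variable {V : Type u} [Category.{v} V] [MonoidalCategory V]

theorem tensorLeftAdjunction_unit_app (M D N : V) [ExactPairing M D] :
    (tensorLeftAdjunction M D).unit.app N = (λ_ N).inv ≫ η_ M D ▷ N ≫ (α_ M D N).hom := by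
  simp [tensorLeftAdjunction, tensorLeftHomEquiv]

theorem tensorLeftAdjunction_counit_app (M D X : V) [ExactPairing M D] :
    (tensorLeftAdjunction M D).counit.app X = (α_ D M X).inv ≫ ε_ M D ▷ X ≫ (λ_ X).hom := by
  simp [tensorLeftAdjunction, tensorLeftHomEquiv]

/-- A section of the evaluation of a dual gives a section of the counit of the tensor
adjunction. -/
def sectionCounit {M D : V} (s : 𝟙_ V ⟶ D ⊗ M) : 𝟭 V ⟶ tensorLeft M ⋙ tensorLeft D where
  app X := (λ_ X).inv ≫ s ▷ X ≫ (α_ D M X).hom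
  naturality X Y f := by
    change f ≫ (λ_ Y).inv ≫ s ▷ Y ≫ (α_ D M Y).hom =
      ((λ_ X).inv ≫ s ▷ X ≫ (α_ D M X).hom) ≫ D ◁ M ◁ f
    rw [leftUnitor_inv_naturality_assoc, whisker_exchange_assoc]
    monoidal

theorem sectionCounit_comp_counit {M D : V} [ExactPairing M D] (s : 𝟙_ V ⟶ D ⊗ M)
    (hs : s ≫ ε_ M D = 𝟙 _) : sectionCounit s ≫ (tensorLeftAdjunction M D).counit = 𝟙 _ := by
  ext X
  rw [NatTrans.comp_app, tensorLeftAdjunction_counit_app]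
  simp [sectionCounit, ← comp_whiskerRight_assoc, hs]

/-- The canonical map is the transpose of the action, so evaluating recovers the action. -/
theorem galoisMap_whiskerRight_evaluation (B : Mon V) (M : Mod V B.X) (D : V)
    [ExactPairing M.X D] :
    galoisMap B M D ▷ M.X ≫ (α_ M.X D M.X).hom ≫ M.X ◁ ε_ M.X D ≫ (ρ_ M.X).hom = action B M := by
  calc _ = 𝟙 _ ⊗≫ B.X ◁ η_ M.X D ▷ M.X ⊗≫ (action B M ▷ (D ⊗ M.X) ≫ M.X ◁ ε_ M.X D) ⊗≫ 𝟙 _ := by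
        rw [galoisMap]; monoidal
    _ = 𝟙 _ ⊗≫ B.X ◁ (η_ M.X D ▷ M.X ⊗≫ M.X ◁ ε_ M.X D) ⊗≫ action B M := by
        rw [← whisker_exchange]; monoidal
    _ = _ := by rw [ExactPairing.evaluation_coevaluation'']; monoidal

theorem one_action (B : Mon V) (N : Mod V B.X) :
    (MonObj.one : 𝟙_ V ⟶ B.X) ▷ N.X ≫ action B N = (λ_ N.X).hom :=
  ModObj.one_smul_self B.X N.X

theorem mul_action (B : Mon V) (N : Mod V B.X) :
    (MonObj.mul : B.X ⊗ B.X ⟶ B.X) ▷ N.X ≫ action B N =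
      (α_ B.X B.X N.X).hom ≫ B.X ◁ action B N ≫ action B N :=
  ModObj.mul_smul_self B.X N.X

theorem action_hom {B : Mon V} {N P : Mod V B.X} (f : N ⟶ P) :
    action B N ≫ f.hom = B.X ◁ f.hom ≫ action B P :=
  IsModHom.smul_hom (A := B.X) (f := f.hom)

/-- A morphism commuting with the actions, as a morphism of modules. -/
def homOfLinear {B : Mon V} {N P : Mod V B.X} (f : N.X ⟶ P.X)
    (hf : action B N ≫ f = B.X ◁ f ≫ action B P) : N ⟶ P :=
  Mod.Hom.mk' f hf

/-! ### B-modules as algebras for the monad M ⊗ D ⊗ - -/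

section DualAction

variable {B : Mon V} (M : Mod V B.X) (D : V) [ExactPairing M.X D]

theorem one_galoisMap : (MonObj.one : 𝟙_ V ⟶ B.X) ≫ galoisMap B M D = η_ M.X D := by
  calc _ = 𝟙 _ ⊗≫ ((MonObj.one : 𝟙_ V ⟶ B.X) ▷ 𝟙_ V ≫ B.X ◁ η_ M.X D) ⊗≫ action B M ▷ D := by
        rw [galoisMap]; monoidal
    _ = 𝟙 _ ⊗≫ η_ M.X D ⊗≫ ((MonObj.one : 𝟙_ V ⟶ B.X) ▷ M.X ≫ action B M) ▷ D := by
        rw [← whisker_exchange]; monoidal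
    _ = _ := by rw [one_action]; monoidal

theorem mul_galoisMap_eq_action :
    (MonObj.mul : B.X ⊗ B.X ⟶ B.X) ≫ galoisMap B M D =
      B.X ◁ galoisMap B M D ≫ (α_ B.X M.X D).inv ≫ action B M ▷ D := by
  calc _ = 𝟙 _ ⊗≫ ((MonObj.mul : B.X ⊗ B.X ⟶ B.X) ▷ 𝟙_ V ≫ B.X ◁ η_ M.X D) ⊗≫
            action B M ▷ D := by
        rw [galoisMap]; monoidal
    _ = 𝟙 _ ⊗≫ (B.X ⊗ B.X) ◁ η_ M.X D ⊗≫
            ((MonObj.mul : B.X ⊗ B.X ⟶ B.X) ▷ M.X ≫ action B M) ▷ D := by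
        rw [← whisker_exchange]; monoidal
    _ = _ := by rw [mul_action, galoisMap]; monoidal

theorem mul_galoisMap :
    (MonObj.mul : B.X ⊗ B.X ⟶ B.X) ≫ galoisMap B M D =
      (galoisMap B M D ▷ B.X ≫ (M.X ⊗ D) ◁ galoisMap B M D) ≫
        (α_ M.X D (M.X ⊗ D)).hom ≫ M.X ◁ (α_ D M.X D).inv ≫ M.X ◁ (ε_ M.X D ▷ D) ≫
          M.X ◁ (λ_ D).hom := by
  rw [mul_galoisMap_eq_action, ← galoisMap_whiskerRight_evaluation B M D, ← whisker_exchange]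
  monoidal

/-- The canonical map is always a morphism of algebras, so only its invertibility matters. -/
theorem isAlgebraIso_galoisMap_iff :
    IsAlgebraIso (A := B) (B := dualAlgebra M.X D) (galoisMap B M D) ↔
      IsIso (galoisMap B M D) := by
  constructor
  · rintro ⟨e, he⟩
    exact ⟨e.inv.hom, by rw [← he]; exact congrArg Mon.Hom.hom e.hom_inv_id,
      by rw [← he]; exact congrArg Mon.Hom.hom e.inv_hom_id⟩
  · intro _
    refine ⟨@Mon.mkIso' V _ _ B.X (dualAlgebra M.X D).X _ _
      (@asIso V _ B.X (M.X ⊗ D) (galoisMap B M D) _) ⟨one_galoisMap M D, ?_⟩, rfl⟩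
    exact (mul_galoisMap M D).trans (by rw [← MonoidalCategory.tensorHom_def]; rfl)

variable [IsIso (galoisMap B M D)]

/-- An action of `B` as an action of the dual algebra `M ⊗ D`, when `B ⟶ M ⊗ D` is invertible. -/
noncomputable def dualAction {N : V} (act : B.X ⊗ N ⟶ N) : M.X ⊗ D ⊗ N ⟶ N :=
  (α_ M.X D N).inv ≫ inv (galoisMap B M D) ▷ N ≫ act

theorem galoisMap_dualAction {N : V} (act : B.X ⊗ N ⟶ N) :
    galoisMap B M D ▷ N ≫ (α_ M.X D N).hom ≫ dualAction M D act = act := by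
  rw [dualAction, Iso.hom_inv_id_assoc, ← comp_whiskerRight_assoc, IsIso.hom_inv_id]
  simp

theorem one_dualAction (N : Mod V B.X) :
    ((λ_ N.X).inv ≫ η_ M.X D ▷ N.X ≫ (α_ M.X D N.X).hom) ≫ dualAction M D (action B N) =
      𝟙 _ := by
  rw [← one_galoisMap, comp_whiskerRight, Category.assoc, Category.assoc, Category.assoc,
    galoisMap_dualAction, one_action, Iso.inv_hom_id]

theorem mul_dualAction (N : Mod V B.X) :
    M.X ◁ D ◁ dualAction M D (action B N) ≫ dualAction M D (action B N) =
      M.X ◁ ((α_ D M.X (D ⊗ N.X)).inv ≫ ε_ M.X D ▷ (D ⊗ N.X) ≫ (λ_ (D ⊗ N.X)).hom) ≫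
        dualAction M D (action B N) := by
  have h1 : ((α_ M.X D (M.X ⊗ D)).hom ≫ M.X ◁ (α_ D M.X D).inv ≫ M.X ◁ (ε_ M.X D ▷ D) ≫
      M.X ◁ (λ_ D).hom) ≫ inv (galoisMap B M D) =
        (inv (galoisMap B M D) ▷ (M.X ⊗ D) ≫ B.X ◁ inv (galoisMap B M D)) ≫ MonObj.mul := by
    rw [IsIso.comp_inv_eq, Category.assoc, mul_galoisMap]
    simp only [Category.assoc]
    rw [whisker_exchange_assoc, ← comp_whiskerRight_assoc,
      ← MonoidalCategory.whiskerLeft_comp_assoc]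
    simp
  calc _ = 𝟙 _ ⊗≫ ((M.X ⊗ D) ◁ (inv (galoisMap B M D) ▷ N.X ≫ action B N) ≫
            inv (galoisMap B M D) ▷ N.X) ≫ action B N := by
        rw [dualAction]; monoidal
    _ = 𝟙 _ ⊗≫ (inv (galoisMap B M D) ▷ (M.X ⊗ D) ≫ B.X ◁ inv (galoisMap B M D)) ▷ N.X ⊗≫
            B.X ◁ action B N ≫ action B N := by
        rw [whisker_exchange]; monoidal
    _ = 𝟙 _ ⊗≫ ((inv (galoisMap B M D) ▷ (M.X ⊗ D) ≫ B.X ◁ inv (galoisMap B M D)) ≫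
            MonObj.mul) ▷ N.X ≫ action B N := by
        rw [comp_whiskerRight _ MonObj.mul, Category.assoc, mul_action]; monoidal
    _ = _ := by
        rw [← h1, dualAction]; monoidal

theorem dualAction_comp_iff {N P : V} (act : B.X ⊗ N ⟶ N) (act' : B.X ⊗ P ⟶ P) (f : N ⟶ P) :
    M.X ◁ D ◁ f ≫ dualAction M D act' = dualAction M D act ≫ f ↔
      act ≫ f = B.X ◁ f ≫ act' := by
  constructor
  · intro hf
    rw [← galoisMap_dualAction M D act, ← galoisMap_dualAction M D act', Category.assoc,
      Category.assoc, ← hf, whisker_exchange_assoc]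
    monoidal
  · intro hf
    rw [dualAction, dualAction, Category.assoc, Category.assoc, hf,
      ← whisker_exchange_assoc]
    monoidal

/-- The module M ⊗ X becomes the algebra whose structure map is M ⊗ counit, that is, the image of X
under the comparison functor. -/
theorem dualAction_tensor (X : V) :
    dualAction M D ((α_ B.X M.X X).inv ≫ action B M ▷ X) =
      M.X ◁ ((α_ D M.X X).inv ≫ ε_ M.X D ▷ X ≫ (λ_ X).hom) := by
  rw [dualAction, ← galoisMap_whiskerRight_evaluation B M D]
  calc _ = 𝟙 _ ⊗≫ (inv (galoisMap B M D) ≫ galoisMap B M D) ▷ M.X ▷ X ⊗≫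
            M.X ◁ ε_ M.X D ▷ X ⊗≫ 𝟙 _ := by
        monoidal
    _ = _ := by rw [IsIso.inv_hom_id]; monoidal

theorem tensorModuleFunctor_isEquivalence [IsIdempotentComplete V]
    (s : 𝟙_ V ⟶ D ⊗ M.X) (hs : s ≫ ε_ M.X D = 𝟙 _) :
    (tensorModuleFunctor B M).IsEquivalence := by
  have ht := sectionCounit_comp_counit s hs
  refine { faithful := ⟨fun {X Y} a b hab => ?_⟩, full := ⟨fun {X Y} u => ?_⟩,
           essSurj := ⟨fun N => ?_⟩ }
  · exact (faithful_of_section_counit _ _ ht).map_injective (congrArg Mod.Hom.hom hab)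
  · let w : M.X ⊗ X ⟶ M.X ⊗ Y := u.hom
    have hw : ((α_ B.X M.X X).inv ≫ action B M ▷ X) ≫ w =
        B.X ◁ w ≫ (α_ B.X M.X Y).inv ≫ action B M ▷ Y := action_hom u
    obtain ⟨f, hf⟩ := exists_map_eq_of_section_counit _ _ ht w (by
      rw [← dualAction_comp_iff M D, dualAction_tensor, dualAction_tensor] at hw
      rw [tensorLeftAdjunction_counit_app, tensorLeftAdjunction_counit_app]
      exact hw)
    exact ⟨f, Mod.hom_ext _ _ hf⟩
  · obtain ⟨X, a, ha⟩ := exists_iso_of_section_counit _ _ ht (dualAction M D (action B N))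
      (by rw [tensorLeftAdjunction_unit_app]; exact one_dualAction M D N)
      (by rw [tensorLeftAdjunction_counit_app]; exact mul_dualAction M D N)
    let b : M.X ⊗ X ≅ N.X := a
    have hb : ((α_ B.X M.X X).inv ≫ action B M ▷ X) ≫ b.hom = B.X ◁ b.hom ≫ action B N := by
      rw [← dualAction_comp_iff M D, dualAction_tensor]
      rw [tensorLeftAdjunction_counit_app] at ha
      exact ha
    have hb' : action B N ≫ b.inv =
        B.X ◁ b.inv ≫ (α_ B.X M.X X).inv ≫ action B M ▷ X := by
      rw [← cancel_mono b.hom, Category.assoc, Category.assoc, hb]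
      simp
    exact ⟨X, ⟨⟨homOfLinear (N := tensorModule B M X) b.hom hb,
      homOfLinear (P := tensorModule B M X) b.inv hb', Mod.hom_ext _ _ b.hom_inv_id,
      Mod.hom_ext _ _ b.inv_hom_id⟩⟩⟩

end DualAction

/-! ### From an equivalence to a dual and a Galois module -/

section FullyFaithful

variable {B : Mon V} (M : Mod V B.X)

theorem exists_whiskerLeft_eq_of_linear [(tensorModuleFunctor B M).Full] {X Y : V}
    (w : M.X ⊗ X ⟶ M.X ⊗ Y)
    (hw : ((α_ B.X M.X X).inv ≫ action B M ▷ X) ≫ w =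
      B.X ◁ w ≫ (α_ B.X M.X Y).inv ≫ action B M ▷ Y) :
    ∃ f : X ⟶ Y, M.X ◁ f = w := by
  obtain ⟨f, hf⟩ := (tensorModuleFunctor B M).map_surjective
    (homOfLinear (N := tensorModule B M X) (P := tensorModule B M Y) w hw)
  exact ⟨f, congrArg Mod.Hom.hom hf⟩

theorem whiskerLeft_injective_of_faithful [(tensorModuleFunctor B M).Faithful] {X Y : V}
    {f g : X ⟶ Y} (h : M.X ◁ f = M.X ◁ g) : f = g :=
  (tensorModuleFunctor B M).map_injective (Mod.hom_ext _ _ h)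

theorem exists_linear_iso_of_essSurj [(tensorModuleFunctor B M).EssSurj] :
    ∃ (D : V) (χ : B.X ≅ M.X ⊗ D),
      (MonObj.mul : B.X ⊗ B.X ⟶ B.X) ≫ χ.hom =
        B.X ◁ χ.hom ≫ (α_ B.X M.X D).inv ≫ action B M ▷ D := by
  let R : Mod V B.X := Mod.regular B.X
  let D := (tensorModuleFunctor B M).objPreimage R
  let i : R ≅ tensorModule B M D := ((tensorModuleFunctor B M).objObjPreimageIso R).symm
  exact ⟨D, ⟨i.hom.hom, i.inv.hom, congrArg Mod.Hom.hom i.hom_inv_id,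
    congrArg Mod.Hom.hom i.inv_hom_id⟩, action_hom i.hom⟩

theorem isGaloisModule_of_isEquivalence [(tensorModuleFunctor B M).IsEquivalence] :
    IsGaloisModule B M := by
  obtain ⟨D, χ, hχ⟩ := exists_linear_iso_of_essSurj M
  have hχ' : ((α_ B.X M.X D).inv ≫ action B M ▷ D) ≫ χ.inv =
      B.X ◁ χ.inv ≫ (MonObj.mul : B.X ⊗ B.X ⟶ B.X) := by
    rw [Iso.comp_inv_eq, Category.assoc, hχ, ← MonoidalCategory.whiskerLeft_comp_assoc]
    simp
  -- Transporting the action along `χ` gives a B-linear map M ⊗ D ⊗ M → M, which by fullness has the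
  -- form M ⊗ ev.
  obtain ⟨ev, hev⟩ := exists_whiskerLeft_eq_of_linear M (X := D ⊗ M.X) (Y := 𝟙_ V)
    ((α_ M.X D M.X).inv ≫ χ.inv ▷ M.X ≫ action B M ≫ (ρ_ M.X).inv) (by
      calc _ = 𝟙 _ ⊗≫ (((α_ B.X M.X D).inv ≫ action B M ▷ D) ≫ χ.inv) ▷ M.X ≫ action B M ⊗≫
                𝟙 _ := by
            monoidal
        _ = 𝟙 _ ⊗≫ B.X ◁ χ.inv ▷ M.X ⊗≫
              ((MonObj.mul : B.X ⊗ B.X ⟶ B.X) ▷ M.X ≫ action B M) ⊗≫ 𝟙 _ := by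
            rw [hχ']; monoidal
        _ = _ := by rw [mul_action]; monoidal)
  have hact : χ.hom ▷ M.X ≫ (α_ M.X D M.X).hom ≫ M.X ◁ ev = action B M ≫ (ρ_ M.X).inv := by
    rw [hev, Iso.hom_inv_id_assoc, ← comp_whiskerRight_assoc]
    simp
  let db : 𝟙_ V ⟶ M.X ⊗ D := MonObj.one ≫ χ.hom
  have hgal : (ρ_ B.X).inv ≫ B.X ◁ db ≫ (α_ B.X M.X D).inv ≫ action B M ▷ D = χ.hom := by
    rw [MonoidalCategory.whiskerLeft_comp, Category.assoc, ← hχ, MonObj.mul_one_assoc]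
    simp
  let P : ExactPairing M.X D :=
    { coevaluation' := db
      evaluation' := ev
      evaluation_coevaluation' := by
        rw [comp_whiskerRight, Category.assoc, hact, ← Category.assoc, one_action]
      coevaluation_evaluation' := by
        -- The first triangle identity is the unit law of the action; the second is checked after
        -- tensoring with M, where `hgal` lets `χ` be cancelled.
        apply whiskerLeft_injective_of_faithful M
        have h1 : M.X ◁ (D ◁ db ≫ (α_ D M.X D).inv ≫ ev ▷ D) =
            M.X ◁ (ρ_ D).hom ≫ χ.inv ≫ χ.hom ≫ M.X ◁ (λ_ D).inv := by
          rw [← hgal]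
          calc _ = 𝟙 _ ⊗≫ (χ.inv ≫ χ.hom) ▷ 𝟙_ V ≫ (M.X ⊗ D) ◁ db ⊗≫ M.X ◁ ev ▷ D := by
                rw [Iso.inv_hom_id]; monoidal
            _ = 𝟙 _ ⊗≫ χ.inv ▷ 𝟙_ V ≫ (χ.hom ▷ 𝟙_ V ≫ (M.X ⊗ D) ◁ db) ⊗≫ M.X ◁ ev ▷ D := by
                monoidal
            _ = 𝟙 _ ⊗≫ χ.inv ▷ 𝟙_ V ≫ B.X ◁ db ⊗≫
                  (χ.hom ▷ M.X ≫ (α_ M.X D M.X).hom ≫ M.X ◁ ev) ▷ D ⊗≫ 𝟙 _ := by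
                rw [← whisker_exchange]; monoidal
            _ = _ := by
                rw [hact]; monoidal
        rw [h1, Iso.inv_hom_id_assoc, MonoidalCategory.whiskerLeft_comp] }
  refine ⟨D, P, (isAlgebraIso_galoisMap_iff M D).2 ?_⟩
  have : galoisMap B M D = χ.hom := hgal
  rw [this]
  infer_instance

end FullyFaithful

/-! ### Linear sections of orbit maps, and splittings of the unit and of ev -/

section LinearSection

variable {B : Mon V} (M : Mod V B.X) (D : V) [ExactPairing M.X D]

/-- The morphism `B ⟶ M` given by the action of `B` on an element of `M`. -/
def orbitMap {B : Mon V} (M : Mod V B.X) (x : 𝟙_ V ⟶ M.X) : B.X ⟶ M.X :=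
  (ρ_ B.X).inv ≫ B.X ◁ x ≫ action B M

theorem mul_orbitMap (x : 𝟙_ V ⟶ M.X) :
    (MonObj.mul : B.X ⊗ B.X ⟶ B.X) ≫ orbitMap M x = B.X ◁ orbitMap M x ≫ action B M := by
  calc _ = 𝟙 _ ⊗≫ ((MonObj.mul : B.X ⊗ B.X ⟶ B.X) ▷ 𝟙_ V ≫ B.X ◁ x) ≫ action B M := by
        rw [orbitMap]; monoidal
    _ = 𝟙 _ ⊗≫ (B.X ⊗ B.X) ◁ x ≫ (MonObj.mul : B.X ⊗ B.X ⟶ B.X) ▷ M.X ≫ action B M := by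
        rw [← whisker_exchange]; monoidal
    _ = _ := by rw [mul_action, orbitMap]; monoidal

/-- A `B`-linear section of the morphism `B ⟶ M` given by an element of `M`. -/
def HasLinearSection {B : Mon V} (M : Mod V B.X) (x : 𝟙_ V ⟶ M.X) : Prop :=
  ∃ σ : M.X ⟶ B.X, σ ≫ orbitMap M x = 𝟙 _ ∧ action B M ≫ σ = B.X ◁ σ ≫ MonObj.mul

theorem isSplitMono_of_hasLinearSection [(tensorModuleFunctor B M).Full]
    [(tensorModuleFunctor B M).Faithful] [IsIso (galoisMap B M D)] {x : 𝟙_ V ⟶ M.X}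
    (h : HasLinearSection M x) : IsSplitMono x := by
  obtain ⟨σ, hσ, hlin⟩ := h
  -- The linear map M → B → M ⊗ D has the form M ⊗ r with r : I → D; pairing r with `x` gives the
  -- retraction.
  obtain ⟨r, hr⟩ := exists_whiskerLeft_eq_of_linear M (X := 𝟙_ V) (Y := D)
    ((ρ_ M.X).hom ≫ σ ≫ galoisMap B M D) (by
      calc _ = 𝟙 _ ⊗≫ (action B M ≫ σ) ≫ galoisMap B M D := by monoidal
        _ = 𝟙 _ ⊗≫ B.X ◁ σ ≫ B.X ◁ galoisMap B M D ≫ (α_ B.X M.X D).inv ≫ action B M ▷ D := by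
            rw [hlin, Category.assoc, mul_galoisMap_eq_action]
        _ = _ := by monoidal)
  refine IsSplitMono.mk' ⟨(λ_ M.X).inv ≫ r ▷ M.X ≫ ε_ M.X D, ?_⟩
  apply whiskerLeft_injective_of_faithful M
  calc _ = 𝟙 _ ⊗≫ M.X ◁ (𝟙_ V ◁ x ≫ r ▷ M.X) ⊗≫ M.X ◁ ε_ M.X D := by monoidal
    _ = 𝟙 _ ⊗≫ (M.X ◁ r) ▷ 𝟙_ V ≫ (M.X ⊗ D) ◁ x ⊗≫ M.X ◁ ε_ M.X D := by
        rw [whisker_exchange]; monoidal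
    _ = 𝟙 _ ⊗≫ σ ▷ 𝟙_ V ≫ (galoisMap B M D ▷ 𝟙_ V ≫ (M.X ⊗ D) ◁ x) ⊗≫ M.X ◁ ε_ M.X D := by
        rw [hr]; monoidal
    _ = 𝟙 _ ⊗≫ σ ▷ 𝟙_ V ≫ B.X ◁ x ≫ (galoisMap B M D ▷ M.X ≫ (α_ M.X D M.X).hom ≫
          M.X ◁ ε_ M.X D ≫ (ρ_ M.X).hom) ≫ (ρ_ M.X).inv := by
        rw [← whisker_exchange]; monoidal
    _ = (ρ_ M.X).hom ≫ (σ ≫ orbitMap M x) ≫ (ρ_ M.X).inv := by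
        rw [galoisMap_whiskerRight_evaluation, orbitMap]; monoidal
    _ = _ := by rw [hσ]; monoidal

theorem inv_galoisMap_linear [IsIso (galoisMap B M D)] :
    ((α_ B.X M.X D).inv ≫ action B M ▷ D) ≫ inv (galoisMap B M D) =
      B.X ◁ inv (galoisMap B M D) ≫ (MonObj.mul : B.X ⊗ B.X ⟶ B.X) := by
  rw [IsIso.comp_inv_eq, Category.assoc, mul_galoisMap_eq_action,
    ← MonoidalCategory.whiskerLeft_comp_assoc]
  simp

/-- The section is M → M ⊗ D ⊗ M ≅ B ⊗ M → B ⊗ B → B. The B-action stays on the left factor, so `j`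
itself need not be linear. -/
theorem hasLinearSection_of_section [IsIso (galoisMap B M D)] {x : 𝟙_ V ⟶ M.X}
    (s : 𝟙_ V ⟶ D ⊗ M.X) (hs : s ≫ ε_ M.X D = 𝟙 _) (j : M.X ⟶ B.X)
    (hj : j ≫ orbitMap M x = 𝟙 _) : HasLinearSection M x := by
  refine ⟨(ρ_ M.X).inv ≫ M.X ◁ s ≫ (α_ M.X D M.X).inv ≫ inv (galoisMap B M D) ▷ M.X ≫
    B.X ◁ j ≫ MonObj.mul, ?_, ?_⟩
  · simp only [Category.assoc]
    rw [mul_orbitMap, ← MonoidalCategory.whiskerLeft_comp_assoc, hj,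
      ← galoisMap_whiskerRight_evaluation B M D, MonoidalCategory.whiskerLeft_id,
      Category.id_comp, ← comp_whiskerRight_assoc, IsIso.inv_hom_id, id_whiskerRight,
      Category.id_comp, Iso.inv_hom_id_assoc, ← MonoidalCategory.whiskerLeft_comp_assoc, hs]
    simp
  · calc _ = 𝟙 _ ⊗≫ (action B M ▷ 𝟙_ V ≫ M.X ◁ s) ⊗≫ inv (galoisMap B M D) ▷ M.X ≫
          B.X ◁ j ≫ MonObj.mul := by monoidal
      _ = 𝟙 _ ⊗≫ B.X ◁ M.X ◁ s ⊗≫ (((α_ B.X M.X D).inv ≫ action B M ▷ D) ≫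
            inv (galoisMap B M D)) ▷ M.X ≫ B.X ◁ j ≫ MonObj.mul := by
          rw [← whisker_exchange]; monoidal
      _ = 𝟙 _ ⊗≫ B.X ◁ M.X ◁ s ⊗≫ B.X ◁ inv (galoisMap B M D) ▷ M.X ⊗≫
            ((MonObj.mul : B.X ⊗ B.X ⟶ B.X) ▷ M.X ≫ B.X ◁ j) ≫ MonObj.mul := by
          rw [inv_galoisMap_linear]; monoidal
      _ = 𝟙 _ ⊗≫ B.X ◁ M.X ◁ s ⊗≫ B.X ◁ inv (galoisMap B M D) ▷ M.X ⊗≫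
            (B.X ⊗ B.X) ◁ j ≫ (MonObj.mul : B.X ⊗ B.X ⟶ B.X) ▷ B.X ≫ MonObj.mul := by
          rw [← whisker_exchange]; monoidal
      _ = _ := by rw [MonObj.mul_assoc]; monoidal

end LinearSection

/-- The retraction of `x` is a functional I → D; tensored with `x` it gives an element of D ⊗ X on
which ev takes the value 1. -/
theorem isSplitEpi_evaluation_of_isSplitMono {X : V} (D : V) [ExactPairing X D] {x : 𝟙_ V ⟶ X}
    [IsSplitMono x] : IsSplitEpi (ε_ X D) := by
  refine IsSplitEpi.mk' ⟨η_ X D ≫ retraction x ▷ D ≫ (λ_ D).hom ≫ (ρ_ D).inv ≫ D ◁ x, ?_⟩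
  calc _ = 𝟙 _ ⊗≫ η_ X D ≫ retraction x ▷ D ⊗≫ (𝟙_ V ◁ D ◁ x ≫ 𝟙_ V ◁ ε_ X D) ⊗≫ 𝟙 _ := by
        monoidal
    _ = 𝟙 _ ⊗≫ η_ X D ▷ 𝟙_ V ⊗≫ (retraction x ▷ (D ⊗ 𝟙_ V) ≫ 𝟙_ V ◁ (D ◁ x ≫ ε_ X D)) ⊗≫
          𝟙 _ := by
        monoidal
    _ = 𝟙 _ ⊗≫ (η_ X D ▷ 𝟙_ V ≫ (X ⊗ D) ◁ x) ⊗≫ (X ◁ ε_ X D ≫ retraction x ▷ 𝟙_ V) ⊗≫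
          𝟙 _ := by
        rw [← whisker_exchange]; monoidal
    _ = 𝟙 _ ⊗≫ x ⊗≫ (η_ X D ▷ X ⊗≫ X ◁ ε_ X D) ⊗≫ retraction x ▷ 𝟙_ V ⊗≫ 𝟙 _ := by
        rw [← whisker_exchange]; monoidal
    _ = 𝟙 _ ⊗≫ (x ≫ retraction x) ⊗≫ 𝟙 _ := by
        rw [ExactPairing.evaluation_coevaluation'']; monoidal
    _ = _ := by rw [IsSplitMono.id]; monoidal

theorem isSplitEpi_evaluation_of_dual {X : V} (D D' : V) [ExactPairing X D]
    [ExactPairing X D'] [IsSplitEpi (ε_ X D)] : IsSplitEpi (ε_ X D') := by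
  have h : (𝟙 D ⊗≫ D ◁ η_ X D' ⊗≫ ε_ X D ▷ D' ⊗≫ 𝟙 D') ▷ X ≫ ε_ X D' = ε_ X D := by
    calc _ = 𝟙 _ ⊗≫ D ◁ η_ X D' ▷ X ⊗≫ (ε_ X D ▷ (D' ⊗ X) ≫ 𝟙_ V ◁ ε_ X D') ⊗≫ 𝟙 _ := by
          monoidal
      _ = 𝟙 _ ⊗≫ D ◁ (η_ X D' ▷ X ⊗≫ X ◁ ε_ X D') ⊗≫ ε_ X D := by
          rw [← whisker_exchange]; monoidal
      _ = _ := by rw [ExactPairing.evaluation_coevaluation'']; monoidal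
  exact IsSplitEpi.mk' ⟨section_ (ε_ X D) ≫ (𝟙 D ⊗≫ D ◁ η_ X D' ⊗≫ ε_ X D ▷ D' ⊗≫ 𝟙 D') ▷ X, by
    rw [Category.assoc, h, IsSplitEpi.id]⟩

end Monoidal

/-! ### Separability and `chiZero` in terms of the enveloping algebra -/

section Braided

open scoped MonObj

variable {V : Type u} [Category.{v} V] [MonoidalCategory V] [BraidedCategory V]

/-- Left multiplication by x ⊗ y braids y past both factors of the argument, multiplies by it on the
right, then by x on the left. This is the form comparable with bimodule linearity. -/
theorem enveloping_mul_eq (A : V) [MonObj A] :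
    tensorμ A A A A ≫ (μ[A] ⊗ₘ ((β_ A A).hom ≫ μ[A])) =
      (α_ A A (A ⊗ A)).hom ≫ A ◁ ((β_ A (A ⊗ A)).hom ≫ (α_ A A A).hom ≫ A ◁ μ[A]) ≫
        (α_ A A A).inv ≫ μ[A] ▷ A := by
  rw [BraidedCategory.braiding_tensor_right_hom, tensorμ, tensorHom_def']
  calc _ = 𝟙 _ ⊗≫ A ◁ (β_ A A).hom ▷ A ⊗≫
        ((A ⊗ A) ◁ ((β_ A A).hom ≫ μ[A])) ≫ μ[A] ▷ A := by monoidal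
    _ = _ := by monoidal

theorem orbitMap_selfModule (A : Mon V) :
    orbitMap (B := envelopingAlgebra A) (selfModule A) η[A.X] = μ[A.X] := by
  change (ρ_ (A.X ⊗ A.X)).inv ≫ (A.X ⊗ A.X) ◁ η[A.X] ≫ envelopingAction A.X = _
  calc _ = 𝟙 _ ⊗≫ A.X ◁ (A.X ◁ η[A.X] ≫ (β_ A.X A.X).hom ≫ μ[A.X]) ≫ μ[A.X] := by
        rw [envelopingAction]; monoidal
    _ = _ := by rw [opposite_mul_one]; monoidal

theorem isSeparableAlgebra_iff (A : Mon V) :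
    IsSeparableAlgebra A ↔ HasLinearSection (B := envelopingAlgebra A) (selfModule A) η[A.X] := by
  have horb : orbitMap (B := envelopingAlgebra A) (selfModule A) η[A.X] = μ[A.X] :=
    orbitMap_selfModule A
  have hlin (ξ : A.X ⟶ A.X ⊗ A.X) :
      (action (envelopingAlgebra A) (selfModule A) ≫ ξ =
        (envelopingAlgebra A).X ◁ ξ ≫ μ[(envelopingAlgebra A).X]) ↔
      envelopingAction A.X ≫ ξ = (α_ A.X A.X A.X).hom ≫
        A.X ◁ ((β_ A.X A.X).hom ≫ ξ ▷ A.X ≫ (α_ A.X A.X A.X).hom ≫ A.X ◁ μ[A.X]) ≫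
          (α_ A.X A.X A.X).inv ≫ μ[A.X] ▷ A.X := by
    have : (A.X ⊗ A.X) ◁ ξ ≫ tensorμ A.X A.X A.X A.X ≫ (μ[A.X] ⊗ₘ ((β_ A.X A.X).hom ≫ μ[A.X])) =
        (α_ A.X A.X A.X).hom ≫
        A.X ◁ ((β_ A.X A.X).hom ≫ ξ ▷ A.X ≫ (α_ A.X A.X A.X).hom ≫ A.X ◁ μ[A.X]) ≫
          (α_ A.X A.X A.X).inv ≫ μ[A.X] ▷ A.X := by
      rw [enveloping_mul_eq, ← BraidedCategory.braiding_naturality_right_assoc]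
      monoidal
    rw [← this]
    rfl
  constructor
  · rintro ⟨ξ, hξ, hr, hl⟩
    refine ⟨ξ, by rw [horb]; exact hξ, (hlin ξ).2 ?_⟩
    rw [hr, envelopingAction]
    calc _ = (α_ A.X A.X A.X).hom ≫ A.X ◁ ((β_ A.X A.X).hom ≫ μ[A.X]) ≫
            A.X ◁ ξ ≫ (α_ A.X A.X A.X).inv ≫ μ[A.X] ▷ A.X := by
          rw [hl]; monoidal
      _ = _ := by monoidal
  · rintro ⟨(ξ : A.X ⟶ A.X ⊗ A.X), hξ, h⟩
    have h := (hlin ξ).1 h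
    -- Restricting linearity to the second factor of the enveloping algebra gives right linearity up
    -- to a braiding, which is invertible.
    have hr : ξ ▷ A.X ≫ (α_ A.X A.X A.X).hom ≫ A.X ◁ μ[A.X] = μ[A.X] ≫ ξ := by
      rw [← cancel_epi (β_ A.X A.X).hom]
      calc _ = 𝟙 _ ⊗≫ 𝟙_ V ◁ ((β_ A.X A.X).hom ≫ ξ ▷ A.X ≫ (α_ A.X A.X A.X).hom ≫
              A.X ◁ μ[A.X]) ⊗≫ (η[A.X] ▷ A.X ≫ μ[A.X]) ▷ A.X := by
            rw [MonObj.one_mul]; monoidal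
        _ = 𝟙 _ ⊗≫ (𝟙_ V ◁ ((β_ A.X A.X).hom ≫ ξ ▷ A.X ≫ (α_ A.X A.X A.X).hom ≫
              A.X ◁ μ[A.X]) ≫ η[A.X] ▷ (A.X ⊗ A.X)) ⊗≫ μ[A.X] ▷ A.X := by
            monoidal
        _ = 𝟙 _ ⊗≫ η[A.X] ▷ A.X ▷ A.X ≫ envelopingAction A.X ≫ ξ := by
            rw [whisker_exchange, h]; monoidal
        _ = 𝟙 _ ⊗≫ (η[A.X] ▷ (A.X ⊗ A.X) ≫ A.X ◁ ((β_ A.X A.X).hom ≫ μ[A.X])) ≫ μ[A.X] ≫ ξ := by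
            rw [envelopingAction]; monoidal
        _ = 𝟙 _ ⊗≫ ((β_ A.X A.X).hom ≫ μ[A.X]) ⊗≫ (η[A.X] ▷ A.X ≫ μ[A.X]) ≫ ξ := by
            rw [← whisker_exchange]; monoidal
        _ = _ := by rw [MonObj.one_mul]; monoidal
    refine ⟨ξ, by rw [← horb]; exact hξ, hr, ?_⟩
    rw [hr, envelopingAction] at h
    -- Inserting the unit in the second factor leaves left linearity.
    have h1 : 𝟙 (A.X ⊗ 𝟙_ V ⊗ A.X) ⊗≫ A.X ◁ (η[A.X] ▷ A.X ≫ (β_ A.X A.X).hom ≫ μ[A.X]) ≫ μ[A.X] ≫ ξ =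
        𝟙 (A.X ⊗ 𝟙_ V ⊗ A.X) ⊗≫ A.X ◁ (η[A.X] ▷ A.X ≫ (β_ A.X A.X).hom ≫ μ[A.X]) ≫ A.X ◁ ξ ≫
          (α_ A.X A.X A.X).inv ≫ μ[A.X] ▷ A.X := by
      have := congrArg (fun f : _ ⟶ A.X ⊗ A.X => (𝟙 _ ⊗≫ A.X ◁ η[A.X] ▷ A.X ⊗≫ f : A.X ⊗ 𝟙_ V ⊗ A.X ⟶ _)) h
      calc _ = _ := by monoidal
        _ = _ := this
        _ = _ := by monoidal
    rw [opposite_one_mul] at h1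
    rw [← cancel_epi (A.X ◁ (λ_ A.X).hom)]
    calc _ = _ := by monoidal
      _ = _ := h1.symm
      _ = _ := by monoidal

theorem chiZero_eq_galoisMap (A : Mon V) (D : V) [p : ExactPairing A.X D] :
    chiZero A D = @galoisMap V _ _ (envelopingAlgebra A) (selfModule A) D p := by
  change _ = (ρ_ (A.X ⊗ A.X)).inv ≫ (A.X ⊗ A.X) ◁ η_ A.X D ≫ (α_ (A.X ⊗ A.X) A.X D).inv ≫
    envelopingAction A.X ▷ D
  rw [chiZero, ← comp_whiskerRight, MonObj.mul_assoc, envelopingAction]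
  monoidal

end Braided

end BraidedAzumaya

open BraidedAzumaya in
theorem mainTheorem11 {V : Type u} [Category.{v} V] [MonoidalCategory V] [BraidedCategory V]
    [HasEqualizers V] [HasCoequalizers V] (A : Mon V) :
    List.TFAE
      [BraidedAzumaya.IsSeparableAlgebra A ∧ BraidedAzumaya.IsLeftAzumaya A,
        BraidedAzumaya.IsProgenerator A.X ∧
          ∃ (D : V) (_ : ExactPairing A.X D),
            BraidedAzumaya.IsAlgebraIso (A := BraidedAzumaya.envelopingAlgebra A)
              (B := BraidedAzumaya.dualAlgebra A.X D) (BraidedAzumaya.chiZero A D),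
        IsSplitMono (MonObj.one : 𝟙_ V ⟶ A.X) ∧
          BraidedAzumaya.IsGaloisModule (BraidedAzumaya.envelopingAlgebra A)
            (BraidedAzumaya.selfModule A)] := by
  tfae_have 1 → 3 := by
    rintro ⟨hsep, haz⟩
    have : (tensorModuleFunctor (envelopingAlgebra A) (selfModule A)).IsEquivalence := haz
    have hgal := isGaloisModule_of_isEquivalence (selfModule A)
    refine ⟨?_, hgal⟩
    obtain ⟨D, p, hD⟩ := hgal
    have := (isAlgebraIso_galoisMap_iff (selfModule A) D).1 hD
    exact isSplitMono_of_hasLinearSection (selfModule A) D ((isSeparableAlgebra_iff A).1 hsep)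
  tfae_have 3 → 2 := by
    rintro ⟨he, D, p, hD⟩
    let q : ExactPairing A.X D := p
    refine ⟨⟨D, q, isSplitEpi_evaluation_of_isSplitMono D (x := (MonObj.one : 𝟙_ V ⟶ A.X))⟩,
      D, q, ?_⟩
    rw [chiZero_eq_galoisMap]
    exact hD
  tfae_have 2 → 1 := by
    rintro ⟨⟨D', p', hD'⟩, D, p, hD⟩
    have : IsSplitEpi (ε_ A.X D) := isSplitEpi_evaluation_of_dual D' D
    obtain ⟨s, hs⟩ : ∃ s, s ≫ ε_ A.X D = 𝟙 _ := ⟨_, IsSplitEpi.id (ε_ A.X D)⟩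
    rw [chiZero_eq_galoisMap] at hD
    let q : ExactPairing (selfModule A).X D := p
    have hiso := (isAlgebraIso_galoisMap_iff (selfModule A) D).1 hD
    -- An idempotent splits through its equaliser with the identity.
    have : IsIdempotentComplete V :=
      (Idempotents.isIdempotentComplete_iff_hasEqualizer_of_id_and_idempotent V).2
        fun _ _ _ => inferInstance
    refine ⟨(isSeparableAlgebra_iff A).2 ?_,
      tensorModuleFunctor_isEquivalence (selfModule A) D s hs⟩
    -- The orbit map is the multiplication, and A ⊗ e is a section of it by the unit law.
    refine hasLinearSection_of_section (selfModule A) D s hs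
      ((ρ_ A.X).inv ≫ A.X ◁ (MonObj.one : 𝟙_ V ⟶ A.X)) ?_
    rw [orbitMap_selfModule]
    change ((ρ_ A.X).inv ≫ A.X ◁ MonObj.one) ≫ MonObj.mul = 𝟙 A.X
    rw [Category.assoc, MonObj.mul_one, Iso.inv_hom_id]
  tfae_finish
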